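/- **Definitions.** Let $0<\beta\le 1$, $0<\alpha\le 2$, $|\theta|\le\min\{\alpha,2-\alpha\}$. The fundamental solution $K^{\theta}_{\alpha,\beta}(\cdot\,;t)$, $t\ge 0$, of the space-time fractional diffusion equation $${}_tD_*^{\beta}u={}_xD_\theta^{\alpha}u,\qquad x\in\mathbb R,\ t\ge 0,\qquad u(x;0)=\delta(x),\quad u(\pm\infty;t)=0,$$ is the family of finite measures on $\mathbb R$ (identified with their densities when these exist) that starts from $\delta_0$ and solves the equation after the Fourier transform in $x$: with $\hat u(\kappa;t)=\int e^{i\kappa x}u(dx;t)$, for every $\kappa\in\mathbb R$ the function $t\mapsto\hat u(\kappa;t)$ is continuous on $[0,\infty)$ and $${}_tD_*^{\beta}\,\hat u(\kappa;t)=-|\kappa|^{\alpha}e^{i\,\mathrm{sign}(\kappa)\theta\pi/2}\,\hat u(\kappa;t).$$ Here the Caputo derivative ${}_tD_*^\beta y$ of a continuous function $y$ is given by its Laplace transform, $\int_0^\infty e^{-st}\,{}_tD_*^{\beta}y(t)\,dt=s^{\beta}\tilde y(s)-s^{\beta-1}y(0)$ for all $s>0$, the Laplace integrals converging absolutely. Write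 $\mathcal G(x;\xi)=e^{-x^2/(4\xi)}/\sqrt{4\pi\xi}$. A real process $W(t)$, $t\ge0$, is H-SSSI if $W(at)$ and $a^{H}W(t)$ have the same finite-dimensional distributions for every $a>0$, and the joint distributions of its increments $W(t+\tau)-W(t)$ are invariant under time shifts $t\to t+s$. **Theorem (stochastic solution of the symmetric space-time fractional diffusion equation).** Let $0<\alpha\le 2$ and $0<\beta\le 1$. Let $G(t)=G_{2\beta/\alpha}(t)$, $t\ge 0$, be a centred Gaussian process with variance $\mathbb E[G(t)^2]=2\,t^{2\beta/\alpha}$, and let $\Lambda=\Lambda_{\alpha/2,\beta}\ge 0$ be a random variable independent of $G$ whose law is the fundamental solution $K^{-\alpha/2}_{\alpha/2,\beta}(d\lambda)=K^{-\alpha/2}_{\alpha/2,\beta}(d\lambda;1)$ at time $1$ (for $\alpha=2,\beta=1$ this is the unit mass at $1$). Put $$X_{\alpha,\beta}(t)=\sqrt{\Lambda_{\alpha/2,\beta}}\;G_{2\beta/\alpha}(t),\qquad t\ge 0.$$ 1. The equation ${}_tD_*^{\beta}u={}_xD_0^{\alpha}u=\partial^\alpha u/\partial|x|^\alpha$ has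 exactly one fundamental solution $K^0_{\alpha,\beta}$ (and $K^{-\alpha/2}_{\alpha/2,\beta}$ is the only fundamental solution of its equation). For every $t\ge 0$ the law of $X_{\alpha,\beta}(t)$ is $K^0_{\alpha,\beta}(\cdot\,;t)$, so $X_{\alpha,\beta}$ is a stochastic solution of this equation. For $t>0$ this law has the density $$K^0_{\alpha,\beta}(x;t)=\int_0^\infty\mathcal G(x;\xi)\,K^{-\alpha/2}_{\alpha/2,\beta}(d\xi;t),$$ which tends to $0$ as $x\to\pm\infty$. 2. The finite-dimensional laws of $X_{\alpha,\beta}$ are variance mixtures of Gaussian laws. For $t_1,\dots,t_n\ge 0$ let $\gamma$ be the covariance matrix of $(G(t_1),\dots,G(t_n))$. Then $$\mathbb P\big((X_{\alpha,\beta}(t_1),\dots,X_{\alpha,\beta}(t_n))\in B\big)=\int_0^\infty \mathcal N(0,\lambda\gamma)(B)\,K^{-\alpha/2}_{\alpha/2,\beta}(d\lambda)$$ for every Borel set $B\subseteq\mathbb R^n$. If $\gamma$ is invertible, the vector has the joint density $$f_{\alpha,\beta}(\mathbf x)=\int_0^\infty\frac{1}{\sqrt{(2\pi\lambda)^n\det\gamma}}\exp\Big\{-\frac1{2\lambda}\mathbf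 x^{T}\gamma^{-1}\mathbf x\Big\}\,K^{-\alpha/2}_{\alpha/2,\beta}(d\lambda).$$ 3. If $G$ is H-SSSI with $H=\beta/\alpha$, then so is $X_{\alpha,\beta}$. -/

import Mathlib

open MeasureTheory ProbabilityTheory Set Filter Topology Matrix
open scoped NNReal ENNReal

noncomputable section

namespace STFD

/-- `IsCaputoDeriv β y v`: on the half-line `t ≥ 0` the function `v` is the Caputo derivative of
order `β ∈ (0,1]` of the continuous function `y`, in the sense of the Laplace transform:
`∫₀^∞ e^{-st} v(t) dt = s^β ỹ(s) - s^{β-1} y(0)` for all `s > 0`. -/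
structure IsCaputoDeriv (β : ℝ) (y v : ℝ → ℂ) : Prop where
  continuousOn : ContinuousOn y (Ici 0)
  integrableOn_fun : ∀ s : ℝ, 0 < s →
    IntegrableOn (fun t : ℝ => (Real.exp (-(s * t)) : ℂ) * y t) (Ioi 0)
  integrableOn_deriv : ∀ s : ℝ, 0 < s →
    IntegrableOn (fun t : ℝ => (Real.exp (-(s * t)) : ℂ) * v t) (Ioi 0)
  laplace : ∀ s : ℝ, 0 < s →
    ∫ t in Ioi (0 : ℝ), (Real.exp (-(s * t)) : ℂ) * v t
      = ((s ^ β : ℝ) : ℂ) * (∫ t in Ioi (0 : ℝ), (Real.exp (-(s * t)) : ℂ) * y t)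
        - ((s ^ (β - 1) : ℝ) : ℂ) * y 0

/-- The Fourier symbol `-|κ|^α e^{i sign(κ) θ π / 2}` of the Riesz–Feller derivative of order `α`
and asymmetry `θ`, for the Fourier transform `û(κ) = ∫ e^{iκx} u(x) dx`. -/
def rieszFellerSymbol (α θ κ : ℝ) : ℂ :=
  -((|κ| ^ α : ℝ) : ℂ) * Complex.exp (Complex.I * ((SignType.sign κ : ℝ) * θ * Real.pi / 2 : ℝ))

/-- The Fourier transform, at frequency `κ`, of the Riesz–Feller derivative of the (generalized)
density `μ`; `charFun μ κ = ∫ e^{iκx} μ(dx)`. -/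
def rieszFellerDerivFourier (α θ : ℝ) (μ : Measure ℝ) (κ : ℝ) : ℂ :=
  rieszFellerSymbol α θ κ * charFun μ κ

/-- `K` is a fundamental solution of the space-time fractional diffusion equation
`ₜD⁎^β u = ₓD_θ^α u`, `u(x;0) = δ(x)`, with `K t` the spatial distribution at time `t`:
a family of finite measures starting from the Dirac mass at `0` that satisfies the equation after
the Fourier transform in space, i.e. at every frequency the Caputo derivative of `û(κ;·)` is the
Fourier transform of the Riesz–Feller derivative. (Finite measures put vanishing mass near `±∞`.)
Measures are used because the solution need not be a function: for `α = β = 1`, `θ = -1` it is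
`δ(x - t)`. -/
structure IsFundamentalSolution (α β θ : ℝ) (K : ℝ≥0 → Measure ℝ) : Prop where
  finite : ∀ t, IsFiniteMeasure (K t)
  initial : K 0 = Measure.dirac 0
  equation : ∀ κ : ℝ, IsCaputoDeriv β
    (fun t : ℝ => charFun (K t.toNNReal) κ)
    (fun t : ℝ => rieszFellerDerivFourier α θ (K t.toNNReal) κ)

open Classical in
/-- The fundamental solution `K_{α,β}^θ(·;t)`, `t ≥ 0` (the zero family if there is none). -/
def fundamentalSolution (α β θ : ℝ) : ℝ≥0 → Measure ℝ :=
  if h : ∃ K, IsFundamentalSolution α β θ K then h.choose else fun _ => 0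

/-- The Gaussian density `𝒢(x;ξ) = e^{-x²/(4ξ)} / √(4πξ)`, of variance `2ξ`. -/
def gaussKernel (x ξ : ℝ) : ℝ :=
  Real.exp (-(x ^ 2 / (4 * ξ))) / Real.sqrt (4 * Real.pi * ξ)

/-- Hurst self-similar process with stationary increments, in the sense of finite-dimensional
distributions. -/
structure IsHSSSI {Ω : Type*} [MeasurableSpace Ω] (H : ℝ) (W : ℝ≥0 → Ω → ℝ) (P : Measure Ω) :
    Prop where
  aemeasurable : ∀ t, AEMeasurable (W t) P
  selfSimilar : ∀ (a : ℝ≥0), 0 < a → ∀ (n : ℕ) (t : Fin n → ℝ≥0),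
    P.map (fun ω i => W (a * t i) ω) = P.map (fun ω i => (a : ℝ) ^ H * W (t i) ω)
  stationaryIncrements : ∀ (s : ℝ≥0) (n : ℕ) (t τ : Fin n → ℝ≥0),
    P.map (fun ω i => W (t i + τ i + s) ω - W (t i + s) ω)
      = P.map (fun ω i => W (t i + τ i) ω - W (t i) ω)

/-- The process `X(t) = √Λ · G(t)`. -/
def scaleMixtureProcess {Ω : Type*} (Λ : Ω → ℝ) (G : ℝ≥0 → Ω → ℝ) (t : ℝ≥0) (ω : Ω) : ℝ :=
  Real.sqrt (Λ ω) * G t ω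

/-- The vector `(W(t₁), …, W(tₙ))`. -/
def timeVector {Ω : Type*} {n : ℕ} (W : ℝ≥0 → Ω → ℝ) (t : Fin n → ℝ≥0) (ω : Ω) :
    EuclideanSpace ℝ (Fin n) :=
  WithLp.toLp 2 (fun i => W (t i) ω)

/-- The covariance matrix of `(W(t₁), …, W(tₙ))`. -/
def covMatrix {Ω : Type*} [MeasurableSpace Ω] {n : ℕ} (W : ℝ≥0 → Ω → ℝ) (P : Measure Ω)
    (t : Fin n → ℝ≥0) : Matrix (Fin n) (Fin n) ℝ :=
  Matrix.of fun i j => covariance (W (t i)) (W (t j)) P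

/-- The density at `x` of a centred Gaussian vector with covariance `l • γ`. -/
def gaussVectorDensity {n : ℕ} (γ : Matrix (Fin n) (Fin n) ℝ) (l : ℝ)
    (x : EuclideanSpace ℝ (Fin n)) : ℝ :=
  (Real.sqrt ((2 * Real.pi * l) ^ n * γ.det))⁻¹ *
    Real.exp (-(1 / (2 * l)) * (x.ofLp ⬝ᵥ (γ⁻¹ *ᵥ x.ofLp)))

end STFD

end

/-! Fourier transform in space and Laplace transform in time turn the equation into the resolvent
identity (s^β - σ(κ)) ũ(κ;s) = s^(β-1), with σ the Riesz–Feller symbol. When Re σ ≤ 0 this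
determines ũ, and injectivity of the Laplace transform (`eqOn_zero_of_laplace_eq_zero`) gives both
uniqueness and self-similarity of fundamental solutions.

Conditioning on Λ, the characteristic function of √Λ G(t) is E exp(-κ² t^(2β/α) Λ), a real Laplace
transform of the law of Λ, whereas the equation for Λ speaks of its Fourier transform. The bridge is
analytic: for θ = -a the symbol is the boundary value of -z^a on the imaginary axis, so by
Phragmén–Lindelöf the resolvent identity extends over the right half-plane to z = x ≥ 0
(`resolvent_mgf_of_resolvent_charFun`). With a = α/2 and x = κ² one has x^a = |κ|^α, and the
extended identity is the resolvent identity of the symmetric equation. Thus the laws of X(t)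
themselves form a fundamental solution, which proves existence. Existence of the solution governing
Λ follows from the assumption on the law of Λ.

The finite-dimensional statements are Fubini for the independent pair (Λ, G). The densities also
need Λ > 0 almost surely, which follows from the extended identity as x → ∞. -/

namespace STFD

/-! ### Injectivity of the Laplace transform. -/

section Laplace

/-- A function whose Laplace transform at the points `1, 2, 3, …` vanishes is orthogonal to
`p (e^{-t}) e^{-t}` for every polynomial `p`. -/
theorem integral_polynomial_exp_mul_eq_zero {f : ℝ → ℂ}
    (hint : ∀ s : ℝ, 0 < s → IntegrableOn (fun t : ℝ => (Real.exp (-(s * t)) : ℂ) * f t) (Ioi 0))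
    (h0 : ∀ s : ℝ, 0 < s → ∫ t in Ioi (0 : ℝ), (Real.exp (-(s * t)) : ℂ) * f t = 0)
    (p : Polynomial ℝ) :
    IntegrableOn (fun t : ℝ => ((p.eval (Real.exp (-t)) : ℝ) : ℂ) *
      ((Real.exp (-(1 * t)) : ℂ) * f t)) (Ioi 0) ∧
    ∫ t in Ioi (0 : ℝ), ((p.eval (Real.exp (-t)) : ℝ) : ℂ) *
      ((Real.exp (-(1 * t)) : ℂ) * f t) = 0 := by
  induction p using Polynomial.induction_on' with
  | add p q hp hq =>
    simp only [Polynomial.eval_add, Complex.ofReal_add, add_mul]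
    refine ⟨hp.1.add hq.1, ?_⟩
    rw [integral_add hp.1 hq.1, hp.2, hq.2, add_zero]
  -- The weight e^(-t) shifts the degree by one: the n-th monomial produces the Laplace transform at
  -- n + 1, which is positive even for n = 0.
  | monomial n c =>
    have hn : (0 : ℝ) < n + 1 := by positivity
    have e : (fun t : ℝ => (((Polynomial.monomial n c).eval (Real.exp (-t)) : ℝ) : ℂ) *
        ((Real.exp (-(1 * t)) : ℂ) * f t))
        = fun t : ℝ => (c : ℂ) * ((Real.exp (-((n + 1 : ℝ) * t)) : ℂ) * f t) := by
      ext t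
      have : Real.exp (-((n + 1 : ℝ) * t)) = Real.exp (-t) ^ n * Real.exp (-(1 * t)) := by
        rw [← Real.exp_nat_mul, ← Real.exp_add]; congr 1; ring
      rw [this, Polynomial.eval_monomial]; push_cast; ring
    rw [e]
    refine ⟨(hint _ hn).const_mul _, ?_⟩
    rw [integral_const_mul, h0 _ hn, mul_zero]

/-- Pulling a test function supported in `(0, ∞)` back along `t = -log x` gives a continuous
function. -/
theorem continuous_comp_neg_log {g : ℝ → ℝ} (hg : Continuous g) (hs : HasCompactSupport g)
    (h0 : g 0 = 0) : Continuous fun x : ℝ => g (-Real.log x) := by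
  rw [continuous_iff_continuousAt]
  intro x
  by_cases hx : x = 0
  · subst hx
    have hz : ∀ᶠ y in 𝓝[≠] (0 : ℝ), g (-Real.log y) = 0 := by
      have h1 : Tendsto (fun y => -Real.log y) (𝓝[≠] (0 : ℝ)) atTop :=
        tendsto_neg_atBot_atTop.comp Real.tendsto_log_nhdsNE_zero
      have h2 : g =ᶠ[cocompact ℝ] 0 := hasCompactSupport_iff_eventuallyEq.1 hs |>.filter_mono (by simp)
      exact (h1.eventually (atTop_le_cocompact h2))
    -- Since `Real.log 0 = 0`, the value at the point 0 itself is `g 0`, which is why `h0` is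
    -- needed.
    have hz' : ∀ᶠ y in 𝓝 (0 : ℝ), g (-Real.log y) = 0 := by
      rw [eventually_nhdsWithin_iff] at hz
      filter_upwards [hz] with y hy
      by_cases h : y = 0
      · simp [h, h0]
      · exact hy h
    have : (fun x : ℝ => g (-Real.log x)) =ᶠ[𝓝 0] fun _ => 0 := hz'
    exact continuousAt_const.congr this.symm
  · exact hg.continuousAt.comp (Real.continuousAt_log hx).neg

/-- Injectivity of the Laplace transform on continuous functions. -/
theorem eqOn_zero_of_laplace_eq_zero {f : ℝ → ℂ} (hc : ContinuousOn f (Ici 0))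
    (hint : ∀ s : ℝ, 0 < s → IntegrableOn (fun t : ℝ => (Real.exp (-(s * t)) : ℂ) * f t) (Ioi 0))
    (h0 : ∀ s : ℝ, 0 < s → ∫ t in Ioi (0 : ℝ), (Real.exp (-(s * t)) : ℂ) * f t = 0) :
    EqOn f 0 (Ici 0) := by
  set h : ℝ → ℂ := fun t => (Real.exp (-(1 * t)) : ℂ) * f t with hh
  have hi : IntegrableOn h (Ioi 0) := hint 1 one_pos
  have hae : ∀ᵐ t ∂(volume : Measure ℝ), t ∈ Ioi (0 : ℝ) → h t = 0 := by
    refine isOpen_Ioi.ae_eq_zero_of_integral_contDiff_smul_eq_zero hi.locallyIntegrableOn ?_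
    intro g hg hgs hgt
    have hg0 : g 0 = 0 := by
      by_contra hne
      exact lt_irrefl (0 : ℝ) (hgt (subset_tsupport g hne))
    have hcφ := continuous_comp_neg_log hg.continuous hgs hg0
    have hrestr : ∫ x, g x • h x = ∫ x in Ioi (0 : ℝ), g x • h x := by
      rw [setIntegral_eq_integral_of_forall_compl_eq_zero]
      intro x hx
      have : g x = 0 := by
        by_contra hne
        exact hx (hgt (subset_tsupport g hne))
      simp [this]
    rw [hrestr]
    have hgi : IntegrableOn (fun x => g x • h x) (Ioi 0) := by
      obtain ⟨C, hC⟩ := hgs.exists_bound_of_continuous hg.continuous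
      exact hi.bdd_smul C hg.continuous.aestronglyMeasurable
        (Eventually.of_forall hC)
    rw [← norm_le_zero_iff]
    refine le_of_forall_pos_le_add fun ε hε => ?_
    set M := ∫ x in Ioi (0 : ℝ), ‖h x‖ with hM
    have hM0 : 0 ≤ M := integral_nonneg fun _ => norm_nonneg _
    -- Weierstrass approximation in the variable e^(-t) ∈ [0, 1]. Dividing by M + 1 rather than M
    -- covers M = 0.
    obtain ⟨p, hp⟩ := exists_polynomial_near_of_continuousOn 0 1 _ hcφ.continuousOn
      (ε / (M + 1)) (by positivity)
    obtain ⟨hpi, hp0⟩ := integral_polynomial_exp_mul_eq_zero hint h0 p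
    rw [zero_add, ← sub_zero (∫ x in Ioi (0 : ℝ), g x • h x), ← hp0, ← integral_sub hgi hpi]
    calc _ ≤ ∫ x in Ioi (0 : ℝ), (ε / (M + 1)) * ‖h x‖ := by
          refine norm_integral_le_of_norm_le (hi.norm.const_mul _) ?_
          refine (ae_restrict_iff' measurableSet_Ioi).2 (Eventually.of_forall fun t ht => ?_)
          have hmem : Real.exp (-t) ∈ Icc (0 : ℝ) 1 :=
            ⟨(Real.exp_pos _).le, Real.exp_le_one_iff.2 (neg_nonpos.2 (le_of_lt ht))⟩
          have := hp _ hmem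
          rw [Real.log_exp, neg_neg] at this
          rw [Complex.real_smul, ← sub_mul, norm_mul, ← Complex.ofReal_sub, Complex.norm_real,
            Real.norm_eq_abs, abs_sub_comm]
          exact mul_le_mul_of_nonneg_right this.le (norm_nonneg _)
      _ = ε / (M + 1) * M := by rw [integral_const_mul]
      _ ≤ ε := by
          rw [div_mul_eq_mul_div, div_le_iff₀ (by positivity)]
          nlinarith
  have hae' : f =ᵐ[volume.restrict (Ioi 0)] fun _ => 0 := by
    rw [EventuallyEq, ae_restrict_iff' measurableSet_Ioi]
    filter_upwards [hae] with t ht htp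
    have := ht htp
    simpa [hh] using this
  have hIoi : EqOn f (fun _ => 0) (Ioi 0) :=
    Measure.eqOn_open_of_ae_eq hae' isOpen_Ioi (hc.mono Ioi_subset_Ici_self) continuousOn_const
  have := hIoi.of_subset_closure hc continuousOn_const Ioi_subset_Ici_self (by simp)
  exact this

end Laplace

/-! ### Uniqueness and self-similarity of fundamental solutions. -/

section FundamentalSolution

variable {α β θ : ℝ} {K K' : ℝ≥0 → Measure ℝ}

theorem IsFundamentalSolution.charFun_zero (hK : IsFundamentalSolution α β θ K) (κ : ℝ) :
    charFun (K (0 : ℝ).toNNReal) κ = 1 := by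
  rw [Real.toNNReal_zero, hK.initial]; simp

/-- The resolvent form of the equation, after Fourier transform in space and Laplace transform in
time. -/
theorem IsFundamentalSolution.resolvent (hK : IsFundamentalSolution α β θ K) (κ : ℝ) {s : ℝ}
    (hs : 0 < s) :
    (((s ^ β : ℝ) : ℂ) - rieszFellerSymbol α θ κ) *
      ∫ t in Ioi (0 : ℝ), (Real.exp (-(s * t)) : ℂ) * charFun (K t.toNNReal) κ
      = ((s ^ (β - 1) : ℝ) : ℂ) := by
  have h := (hK.equation κ).laplace s hs
  simp only [rieszFellerDerivFourier] at h
  rw [hK.charFun_zero κ] at h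
  simp_rw [mul_left_comm _ (rieszFellerSymbol α θ κ)] at h
  rw [integral_const_mul] at h
  rw [sub_mul, h]; ring

theorem rpow_sub_ne_zero_of_re_nonpos {c : ℂ} (hc : c.re ≤ 0) {s : ℝ} (hs : 0 < s) :
    ((s ^ β : ℝ) : ℂ) - c ≠ 0 := by
  intro h
  have := congrArg Complex.re h
  simp only [Complex.sub_re, Complex.ofReal_re, Complex.zero_re] at this
  have := Real.rpow_pos_of_pos hs β
  linarith

/-- The factor s^β - σ(κ) of the resolvent identity has positive real part, so it can be cancelled;
the two Fourier transforms then share their Laplace transform in time. -/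
theorem IsFundamentalSolution.unique (hsymb : ∀ κ, (rieszFellerSymbol α θ κ).re ≤ 0)
    (hK : IsFundamentalSolution α β θ K) (hK' : IsFundamentalSolution α β θ K') : K = K' := by
  funext t
  have := hK.finite t
  have := hK'.finite t
  refine Measure.ext_of_charFun (funext fun κ => ?_)
  have h : EqOn (fun t : ℝ => charFun (K t.toNNReal) κ - charFun (K' t.toNNReal) κ) 0 (Ici 0) := by
    have hi : ∀ s : ℝ, 0 < s → _ := (hK.equation κ).integrableOn_fun
    have hi' : ∀ s : ℝ, 0 < s → _ := (hK'.equation κ).integrableOn_fun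
    refine eqOn_zero_of_laplace_eq_zero
      ((hK.equation κ).continuousOn.sub (hK'.equation κ).continuousOn) ?_ ?_
    · intro s hs
      simp_rw [mul_sub]
      exact (hi s hs).sub (hi' s hs)
    · intro s hs
      simp_rw [mul_sub]
      rw [integral_sub (hi s hs) (hi' s hs), sub_eq_zero]
      refine mul_left_cancel₀ (rpow_sub_ne_zero_of_re_nonpos (β := β) (hsymb κ) hs) ?_
      rw [hK.resolvent κ hs, hK'.resolvent κ hs]
  simpa [sub_eq_zero] using h (mem_Ici.2 t.2)

theorem isFundamentalSolution_fundamentalSolution (h : ∃ K, IsFundamentalSolution α β θ K) :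
    IsFundamentalSolution α β θ (fundamentalSolution α β θ) := by
  rw [fundamentalSolution, dif_pos h]
  exact h.choose_spec

/-- The default family is zero, so one nonzero value certifies existence. The probability law of Λ
supplies such a value. -/
theorem isFundamentalSolution_of_ne_zero {t : ℝ≥0} (h : fundamentalSolution α β θ t ≠ 0) :
    IsFundamentalSolution α β θ (fundamentalSolution α β θ) := by
  refine isFundamentalSolution_fundamentalSolution ?_
  by_contra hne
  exact h (by rw [fundamentalSolution, dif_neg hne])

theorem rieszFellerSymbol_mul_of_pos {r : ℝ} (hr : 0 < r) (κ : ℝ) :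
    rieszFellerSymbol α θ (r * κ) = ((r ^ α : ℝ) : ℂ) * rieszFellerSymbol α θ κ := by
  have : SignType.sign (r * κ) = SignType.sign κ := by
    rw [sign_mul, sign_pos hr, one_mul]
  rw [rieszFellerSymbol, rieszFellerSymbol, this, abs_mul, abs_of_pos hr,
    Real.mul_rpow hr.le (abs_nonneg _)]
  push_cast; ring

/-- The fundamental solution is self-similar. -/
theorem IsFundamentalSolution.charFun_scaling (hα : 0 < α)
    (hsymb : ∀ κ, (rieszFellerSymbol α θ κ).re ≤ 0)
    (hK : IsFundamentalSolution α β θ K) (κ : ℝ) {r : ℝ} (hr : 0 < r) :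
    charFun (K r.toNNReal) κ = charFun (K 1) (r ^ (β / α) * κ) := by
  set κ' := r ^ (β / α) * κ with hκ'
  -- The symbol is homogeneous of degree α, so the exponent β/α produces the factor r^β that matches
  -- the change s ↦ s/r coming from the time dilation.
  have hsy : rieszFellerSymbol α θ κ' = ((r ^ β : ℝ) : ℂ) * rieszFellerSymbol α θ κ := by
    rw [hκ', rieszFellerSymbol_mul_of_pos (Real.rpow_pos_of_pos hr _), ← Real.rpow_mul hr.le,
      div_mul_cancel₀ _ hα.ne']
  have hchg : ∀ s : ℝ, (fun t : ℝ => (Real.exp (-(s * t)) : ℂ) * charFun (K (r * t).toNNReal) κ)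
      = fun t => (fun u : ℝ => (Real.exp (-(s / r * u)) : ℂ) * charFun (K u.toNNReal) κ) (r * t) := by
    intro s; ext t
    have : s / r * (r * t) = s * t := by field_simp
    simp only [this]
  have hi : ∀ s : ℝ, 0 < s → _ := (hK.equation κ).integrableOn_fun
  have hi' : ∀ s : ℝ, 0 < s → _ := (hK.equation κ').integrableOn_fun
  have hir : ∀ s : ℝ, 0 < s →
      IntegrableOn (fun t : ℝ => (Real.exp (-(s * t)) : ℂ) * charFun (K (r * t).toNNReal) κ)
        (Ioi 0) := by
    intro s hs
    rw [hchg s]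
    refine (integrableOn_Ioi_comp_mul_left_iff
      (fun u : ℝ => (Real.exp (-(s / r * u)) : ℂ) * charFun (K u.toNNReal) κ) 0 hr).2 ?_
    rw [mul_zero]
    exact hi (s / r) (by positivity)
  have h : EqOn (fun t : ℝ => charFun (K (r * t).toNNReal) κ - charFun (K t.toNNReal) κ') 0
      (Ici 0) := by
    refine eqOn_zero_of_laplace_eq_zero (ContinuousOn.sub ?_ (hK.equation κ').continuousOn) ?_ ?_
    · refine (hK.equation κ).continuousOn.comp (f := fun t : ℝ => r * t) (by fun_prop) ?_
      intro t ht
      exact mul_nonneg hr.le ht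
    · intro s hs
      simp_rw [mul_sub]
      exact (hir s hs).sub (hi' s hs)
    · intro s hs
      simp_rw [mul_sub]
      rw [integral_sub (hir s hs) (hi' s hs), sub_eq_zero]
      refine mul_left_cancel₀ (rpow_sub_ne_zero_of_re_nonpos (β := β) (hsymb κ') hs) ?_
      rw [hK.resolvent κ' hs, hchg s, integral_comp_mul_left_Ioi
        (fun u : ℝ => (Real.exp (-(s / r * u)) : ℂ) * charFun (K u.toNNReal) κ) 0 hr, mul_zero, hsy]
      have h1 := hK.resolvent κ (s := s / r) (by positivity)
      rw [Real.div_rpow hs.le hr.le, Real.div_rpow hs.le hr.le] at h1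
      have hrβ : ((r ^ β : ℝ) : ℂ) ≠ 0 := by
        exact_mod_cast (Real.rpow_pos_of_pos hr β).ne'
      have hrc : (r : ℂ) ≠ 0 := by exact_mod_cast hr.ne'
      have h2 : ((r ^ (β - 1) : ℝ) : ℂ) = ((r ^ β : ℝ) : ℂ) / r := by
        rw [Real.rpow_sub_one hr.ne']; push_cast; ring
      push_cast [h2] at h1 ⊢
      rw [Complex.real_smul]
      push_cast
      generalize (∫ t in Ioi (0 : ℝ), _ : ℂ) = J at h1 ⊢
      field_simp at h1 ⊢
      linear_combination h1
  have := h (mem_Ici.2 zero_le_one)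
  simpa [sub_eq_zero] using this

theorem IsFundamentalSolution.eq_map (hα : 0 < α)
    (hsymb : ∀ κ, (rieszFellerSymbol α θ κ).re ≤ 0)
    (hK : IsFundamentalSolution α β θ K) {t : ℝ≥0} (ht : 0 < t) :
    K t = (K 1).map (fun x => (t : ℝ) ^ (β / α) * x) := by
  have := hK.finite t
  have := hK.finite 1
  refine Measure.ext_of_charFun (funext fun κ => ?_)
  rw [charFun_map_mul, ← hK.charFun_scaling hα hsymb κ (r := t) ht, Real.toNNReal_coe]

end FundamentalSolution

/-! ### Holomorphic functions on the right half-plane, and the extremal symbol as a boundary value.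
-/

section HalfPlane

/-- A bounded holomorphic function on the right half-plane is determined by its values on the
imaginary axis. -/
theorem eq_of_eq_on_imaginary_axis {f g : ℂ → ℂ} (hf : DiffContOnCl ℂ f {z | 0 < z.re})
    (hg : DiffContOnCl ℂ g {z | 0 < z.re}) {C : ℝ}
    (hC : ∀ z : ℂ, 0 < z.re → ‖f z - g z‖ ≤ C)
    (him : ∀ x : ℝ, f (x * Complex.I) = g (x * Complex.I)) {z : ℂ} (hz : 0 ≤ z.re) :
    f z = g z := by
  -- The difference is bounded, so the growth condition exp(B‖z‖^c) with c < 2 holds with c = B = 0;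
  -- the bound 0 on the axis then propagates inside.
  have h := PhragmenLindelof.right_half_plane_of_bounded_on_real (C := 0) (hf.sub hg)
    ⟨0, by norm_num, 0, ?_⟩ ?_ (fun x => by simp [him]) hz
  · simpa [sub_eq_zero] using h
  · simp only [zero_mul, Real.exp_zero]
    refine Asymptotics.IsBigO.of_bound C ?_
    filter_upwards [mem_inf_of_right (mem_principal_self _)] with z hz
    simpa using hC z hz
  · refine ⟨C, ?_⟩
    rw [eventually_map]
    filter_upwards [eventually_gt_atTop 0] with x hx
    exact hC x (by simpa using hx)

/-- As a ≤ 1, the argument a·arg z stays within [-π/2, π/2]. -/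
theorem re_cpow_nonneg {a : ℝ} (ha₀ : 0 < a) (ha₁ : a ≤ 1) {z : ℂ} (hz : 0 ≤ z.re) :
    0 ≤ (z ^ (a : ℂ)).re := by
  rw [Complex.cpow_ofReal_re]
  have h := Complex.abs_arg_le_pi_div_two_iff.2 hz
  refine mul_nonneg (by positivity) (Real.cos_nonneg_of_mem_Icc ?_)
  rw [mem_Icc, ← abs_le, abs_mul, abs_of_pos ha₀]
  nlinarith [abs_nonneg z.arg]

/-- This singles out the asymmetry θ = -a: only there is the symbol a boundary value of -z^a. The
frequency is -x because e^(-zλ) at z = ix is the Fourier kernel at -x. -/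
theorem mul_I_cpow {a : ℝ} (ha₀ : 0 < a) (x : ℝ) :
    ((x : ℂ) * Complex.I) ^ (a : ℂ) = -rieszFellerSymbol a (-a) (-x) := by
  have key : ∀ y : ℝ, 0 < y → ∀ w : ℂ, w ≠ 0 → ((y : ℂ) * w) ^ (a : ℂ)
      = ((y ^ a : ℝ) : ℂ) * Complex.exp (Complex.log w * a) := by
    intro y hy w hw
    have hy' : (y : ℂ) ≠ 0 := by exact_mod_cast hy.ne'
    rw [Complex.cpow_def_of_ne_zero (mul_ne_zero hy' hw), Complex.log_ofReal_mul hy hw, add_mul,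
      Complex.exp_add, Complex.ofReal_cpow hy.le, Complex.cpow_def_of_ne_zero hy',
      Complex.ofReal_log hy.le]
  rcases lt_trichotomy x 0 with hx | rfl | hx
  · have := key (-x) (by linarith) (-Complex.I) (by simp)
    rw [Complex.log_neg_I] at this
    rw [show (x : ℂ) * Complex.I = ((-x : ℝ) : ℂ) * (-Complex.I) by push_cast; ring, this,
      rieszFellerSymbol, sign_pos (by linarith : 0 < -x), abs_of_pos (by linarith : 0 < -x)]
    simp only [SignType.coe_one]; push_cast
    rw [neg_mul (_ : ℂ) (Complex.exp _), neg_neg]; congr 2; ring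
  · rw [rieszFellerSymbol]
    simp [ha₀.ne']
  · have := key x hx Complex.I (by simp)
    rw [Complex.log_I] at this
    rw [this, rieszFellerSymbol, sign_neg (by linarith : -x < 0), abs_neg, abs_of_pos hx]
    simp only [SignType.coe_neg_one]; push_cast
    rw [neg_mul (_ : ℂ) (Complex.exp _), neg_neg]; congr 2; ring

theorem rieszFellerSymbol_neg_re_nonpos {a : ℝ} (ha₀ : 0 < a) (ha₁ : a ≤ 1) (κ : ℝ) :
    (rieszFellerSymbol a (-a) κ).re ≤ 0 := by
  have h := mul_I_cpow ha₀ (-κ)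
  rw [neg_neg] at h
  have := re_cpow_nonneg ha₀ ha₁ (z := ((-κ : ℝ) : ℂ) * Complex.I) (by simp)
  rw [h, Complex.neg_re] at this
  linarith

theorem rieszFellerSymbol_symm (α κ : ℝ) :
    rieszFellerSymbol α 0 κ = -((|κ| ^ α : ℝ) : ℂ) := by
  simp [rieszFellerSymbol]

variable {Ω' : Type*} [MeasurableSpace Ω'] {ν : Measure Ω'} [IsFiniteMeasure ν] {Z : Ω' → ℝ}

theorem norm_cexp_neg_mul_le {z : ℂ} (hz : 0 ≤ z.re) {x : ℝ} (hx : 0 ≤ x) :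
    ‖Complex.exp (-z * x)‖ ≤ 1 := by
  rw [Complex.norm_exp, Real.exp_le_one_iff]
  simp only [Complex.mul_re, Complex.neg_re, Complex.ofReal_re, Complex.ofReal_im, mul_zero,
    sub_zero]
  nlinarith

theorem norm_complexMGF_neg_le (hZ₀ : ∀ᵐ ω ∂ν, 0 ≤ Z ω) {z : ℂ} (hz : 0 ≤ z.re) :
    ‖complexMGF Z ν (-z)‖ ≤ ν.real univ := by
  have := norm_integral_le_of_norm_le_const (μ := ν) (C := 1)
    (f := fun ω => Complex.exp (-z * Z ω))
    (by filter_upwards [hZ₀] with ω h using norm_cexp_neg_mul_le hz h)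
  simpa [complexMGF] using this

/-- The Laplace transform of a nonnegative variable is holomorphic on the right half-plane and
continuous up to the boundary. -/
theorem diffContOnCl_complexMGF_neg (hZ : AEMeasurable Z ν) (hZ₀ : ∀ᵐ ω ∂ν, 0 ≤ Z ω) :
    DiffContOnCl ℂ (fun z => complexMGF Z ν (-z)) {z | 0 < z.re} := by
  constructor
  · have hsub : Iic (0 : ℝ) ⊆ integrableExpSet Z ν := by
      intro y hy
      refine Integrable.of_bound (by fun_prop) 1 ?_
      filter_upwards [hZ₀] with ω h
      rw [Real.norm_eq_abs, Real.abs_exp, Real.exp_le_one_iff]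
      exact mul_nonpos_of_nonpos_of_nonneg hy h
    have hint := interior_mono hsub
    rw [interior_Iic] at hint
    refine differentiableOn_complexMGF.comp (by fun_prop) ?_
    intro z hz
    exact hint (by simpa using hz)
  · rw [Complex.closure_setOfPred_lt_re]
    refine continuousOn_of_dominated (bound := fun _ => 1) ?_ ?_ (by fun_prop) ?_
    · intro z _
      fun_prop
    · intro z hz
      filter_upwards [hZ₀] with ω h using norm_cexp_neg_mul_le hz h
    · exact Eventually.of_forall fun ω => by fun_prop

end HalfPlane

/-! ### Transfer of the resolvent identity from the Fourier to the Laplace side. -/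

section LaplaceOfLaw

variable {ρ : Measure ℝ} [IsProbabilityMeasure ρ]

theorem continuousOn_mgf_neg (hρ : ∀ᵐ l ∂ρ, 0 ≤ l) :
    ContinuousOn (fun y : ℝ => mgf id ρ (-y)) (Ici 0) := by
  have h := (diffContOnCl_complexMGF_neg (Z := id) aemeasurable_id hρ).continuousOn
  rw [Complex.closure_setOfPred_lt_re] at h
  have h2 : ContinuousOn (fun y : ℝ => (complexMGF id ρ (-(y : ℂ))).re) (Ici 0) := by
    refine Complex.continuous_re.comp_continuousOn (h.comp (by fun_prop) ?_)
    intro y hy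
    simpa using hy
  refine h2.congr fun y _ => ?_
  simp only [← Complex.ofReal_neg, complexMGF_ofReal, Complex.ofReal_re]

theorem mgf_neg_le_one (hρ : ∀ᵐ l ∂ρ, 0 ≤ l) {y : ℝ} (hy : 0 ≤ y) : mgf id ρ (-y) ≤ 1 := by
  have := norm_complexMGF_neg_le (Z := id) hρ (z := (y : ℂ)) (by simpa using hy)
  rw [← Complex.ofReal_neg, complexMGF_ofReal, Complex.norm_real] at this
  exact (le_abs_self _).trans (by simpa using this)

theorem integrableOn_exp_neg_mul_mgf (hρ : ∀ᵐ l ∂ρ, 0 ≤ l) {b x : ℝ} (hb : 0 < b) (hx : 0 ≤ x)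
    {s : ℝ} (hs : 0 < s) :
    IntegrableOn (fun t : ℝ => Real.exp (-(s * t)) * mgf id ρ (-(x * t ^ b))) (Ioi 0) := by
  have he : IntegrableOn (fun t : ℝ => Real.exp (-(s * t))) (Ioi 0) := by
    simpa only [neg_mul] using exp_neg_integrableOn_Ioi 0 hs
  refine Integrable.mul_bdd (c := 1) he ?_ ?_
  · refine ContinuousOn.aestronglyMeasurable ?_ measurableSet_Ioi
    refine (continuousOn_mgf_neg hρ).comp (f := fun t : ℝ => x * t ^ b) ?_ ?_
    · exact (continuous_const.mul (Real.continuous_rpow_const hb.le)).continuousOn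
    · intro t ht
      exact mul_nonneg hx (Real.rpow_nonneg (le_of_lt ht) _)
  · refine (ae_restrict_iff' measurableSet_Ioi).2 (Eventually.of_forall fun t ht => ?_)
    rw [Real.norm_eq_abs, abs_of_nonneg mgf_nonneg]
    exact mgf_neg_le_one hρ (mul_nonneg hx (Real.rpow_nonneg (le_of_lt ht) _))

/-- The measure `e^{-st} dt` on the half-line. -/
noncomputable def expWeight (s : ℝ) : Measure ℝ :=
  (volume.restrict (Ioi 0)).withDensity fun t => ENNReal.ofReal (Real.exp (-(s * t)))

theorem isFiniteMeasure_expWeight {s : ℝ} (hs : 0 < s) : IsFiniteMeasure (expWeight s) := by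
  have he : IntegrableOn (fun t : ℝ => Real.exp (-(s * t))) (Ioi 0) := by
    simpa only [neg_mul] using exp_neg_integrableOn_Ioi 0 hs
  exact isFiniteMeasure_withDensity_ofReal he.2

theorem integral_expWeight (s : ℝ) (f : ℝ → ℂ) :
    ∫ t, f t ∂(expWeight s) = ∫ t in Ioi (0 : ℝ), (Real.exp (-(s * t)) : ℂ) * f t := by
  rw [expWeight, integral_withDensity_eq_integral_toReal_smul (by fun_prop)
    (Eventually.of_forall fun _ => ENNReal.ofReal_lt_top)]
  simp_rw [ENNReal.toReal_ofReal (Real.exp_pos _).le, Complex.real_smul]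

theorem ae_expWeight_pos (s : ℝ) : ∀ᵐ t ∂(expWeight s), 0 < t :=
  (withDensity_absolutelyContinuous _ _).ae_le (ae_restrict_mem measurableSet_Ioi)

/-- Time and mixing variable together form one nonnegative variable t^b λ under a finite product
measure, so holomorphy and boundedness of the time-transformed quantity come from the general facts
on `complexMGF`. -/
theorem complexMGF_prod_expWeight (hρ : ∀ᵐ l ∂ρ, 0 ≤ l) (b : ℝ) {s : ℝ} (hs : 0 < s) {z : ℂ}
    (hz : 0 ≤ z.re) :
    complexMGF (fun p : ℝ × ℝ => p.1 ^ b * p.2) ((expWeight s).prod ρ) (-z)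
      = ∫ t in Ioi (0 : ℝ), (Real.exp (-(s * t)) : ℂ) *
        complexMGF id ρ (-z * ((t ^ b : ℝ) : ℂ)) := by
  have := isFiniteMeasure_expWeight hs
  rw [complexMGF, integral_prod, integral_expWeight]
  · simp only [complexMGF, id_eq, Complex.ofReal_mul, mul_assoc]
  · refine Integrable.of_bound (by fun_prop) 1 ?_
    filter_upwards [Measure.quasiMeasurePreserving_fst.ae (ae_expWeight_pos s),
      Measure.quasiMeasurePreserving_snd.ae hρ] with p h1 h2
    exact norm_cexp_neg_mul_le hz (mul_nonneg (Real.rpow_nonneg h1.le _) h2)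

/-- The resolvent equation for the characteristic functions of `t ^ (β / a) • Λ` extends from the
imaginary axis to the positive real axis. -/
theorem resolvent_mgf_of_resolvent_charFun (hρ : ∀ᵐ l ∂ρ, 0 ≤ l) {a b β : ℝ} (ha₀ : 0 < a)
    (ha₁ : a ≤ 1) {s : ℝ} (hs : 0 < s)
    (H : ∀ κ : ℝ, (((s ^ β : ℝ) : ℂ) - rieszFellerSymbol a (-a) κ) *
      ∫ t in Ioi (0 : ℝ), (Real.exp (-(s * t)) : ℂ) * charFun ρ (t ^ b * κ)
      = ((s ^ (β - 1) : ℝ) : ℂ)) {x : ℝ} (hx : 0 ≤ x) :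
    (s ^ β + x ^ a) * ∫ t in Ioi (0 : ℝ), Real.exp (-(s * t)) * mgf id ρ (-(x * t ^ b))
      = s ^ (β - 1) := by
  have := isFiniteMeasure_expWeight hs
  set Z : ℝ × ℝ → ℝ := fun p => p.1 ^ b * p.2 with hZ
  set ν := (expWeight s).prod ρ with hν
  have hZm : AEMeasurable Z ν := by fun_prop
  have hZ₀ : ∀ᵐ p ∂ν, 0 ≤ Z p := by
    filter_upwards [Measure.quasiMeasurePreserving_fst.ae (ae_expWeight_pos s),
      Measure.quasiMeasurePreserving_snd.ae hρ] with p h1 h2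
    exact mul_nonneg (Real.rpow_nonneg h1.le _) h2
  have hΦ := diffContOnCl_complexMGF_neg hZm hZ₀
  set Ψ : ℂ → ℂ := fun z => ((s ^ (β - 1) : ℝ) : ℂ) / (((s ^ β : ℝ) : ℂ) + z ^ (a : ℂ)) with hΨ
  have hsβ : 0 < s ^ β := Real.rpow_pos_of_pos hs β
  -- Since Re z^a ≥ 0, the denominator stays away from 0, which makes Ψ both holomorphic and
  -- bounded.
  have hlow : ∀ z : ℂ, 0 ≤ z.re → s ^ β ≤ ‖((s ^ β : ℝ) : ℂ) + z ^ (a : ℂ)‖ := fun z hz => by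
    refine le_trans ?_ (Complex.re_le_norm _)
    have := re_cpow_nonneg ha₀ ha₁ hz
    rw [Complex.add_re, Complex.ofReal_re]
    linarith
  have hne : ∀ z : ℂ, 0 ≤ z.re → ((s ^ β : ℝ) : ℂ) + z ^ (a : ℂ) ≠ 0 := fun z hz =>
    norm_pos_iff.1 (hsβ.trans_le (hlow z hz))
  have hΨd : DiffContOnCl ℂ Ψ {z | 0 < z.re} := by
    constructor
    · intro z hz
      refine DifferentiableAt.differentiableWithinAt ?_
      refine (differentiableAt_const _).div ?_ (hne z (le_of_lt hz))
      exact (differentiableAt_const _).add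
        ((differentiableAt_id).cpow_const (Or.inl hz))
    · rw [Complex.closure_setOfPred_lt_re]
      intro z hz
      refine ContinuousAt.continuousWithinAt ?_
      refine continuousAt_const.div ?_ (hne z hz)
      refine continuousAt_const.add ?_
      exact Complex.continuousAt_cpow_const_of_re_pos (Or.inl hz) (by simpa using ha₀)
  have hbd : ∀ z : ℂ, 0 < z.re →
      ‖complexMGF Z ν (-z) - Ψ z‖ ≤ ν.real univ + s ^ (β - 1) / s ^ β := fun z hz => by
    refine (norm_sub_le _ _).trans (add_le_add (norm_complexMGF_neg_le hZ₀ hz.le) ?_)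
    rw [hΨ, norm_div, Complex.norm_real, Real.norm_eq_abs,
      abs_of_pos (Real.rpow_pos_of_pos hs _)]
    have := hlow z hz.le
    gcongr
  have him : ∀ y : ℝ, complexMGF Z ν (-(y * Complex.I)) = Ψ (y * Complex.I) := fun y => by
    have h0 : 0 ≤ ((y : ℂ) * Complex.I).re := by simp
    rw [hΨ, eq_div_iff (hne _ h0), mul_comm, mul_I_cpow ha₀, ← sub_eq_add_neg, ← H (-y),
      complexMGF_prod_expWeight hρ b hs h0]
    congr 2
    ext t
    rw [← complexMGF_id_mul_I]
    congr 2
    push_cast; ring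
  have hfin := eq_of_eq_on_imaginary_axis hΦ hΨd hbd him (z := (x : ℂ)) (by simpa using hx)
  have hx0 : 0 ≤ ((x : ℂ)).re := by simpa using hx
  rw [hΨ, eq_div_iff (hne _ hx0), mul_comm, complexMGF_prod_expWeight hρ b hs hx0] at hfin
  have e : ∀ t : ℝ, (Real.exp (-(s * t)) : ℂ) * complexMGF id ρ (-(x : ℂ) * ((t ^ b : ℝ) : ℂ))
      = ((Real.exp (-(s * t)) * mgf id ρ (-(x * t ^ b)) : ℝ) : ℂ) := fun t => by
    rw [Complex.ofReal_mul, ← complexMGF_ofReal]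
    push_cast; rw [neg_mul]
  simp_rw [e] at hfin
  rw [integral_complex_ofReal, ← Complex.ofReal_cpow hx] at hfin
  exact_mod_cast hfin

theorem measureReal_singleton_zero_le_mgf (hρ : ∀ᵐ l ∂ρ, 0 ≤ l) {y : ℝ} (hy : 0 ≤ y) :
    ρ.real {0} ≤ mgf id ρ (-y) := by
  rw [mgf, ← integral_indicator_one (measurableSet_singleton 0)]
  refine integral_mono_ae ((integrable_const _).indicator (measurableSet_singleton 0)) ?_ ?_
  · refine Integrable.of_bound (by fun_prop) 1 ?_
    filter_upwards [hρ] with l hl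
    rw [Real.norm_eq_abs, Real.abs_exp, Real.exp_le_one_iff, id]
    nlinarith
  · refine Eventually.of_forall fun l => ?_
    by_cases h : l = 0
    · simp [h]
    · simp [h, Real.exp_nonneg]

/-- A law with the resolvent equation has no atom at `0`. -/
theorem measure_singleton_zero_of_resolvent (hρ : ∀ᵐ l ∂ρ, 0 ≤ l) {a b : ℝ} (ha₀ : 0 < a)
    (hb : 0 < b)
    (H : ∀ x : ℝ, 0 ≤ x → (1 + x ^ a) *
      ∫ t in Ioi (0 : ℝ), Real.exp (-(1 * t)) * mgf id ρ (-(x * t ^ b)) = 1) :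
    ρ {0} = 0 := by
  -- The atom bounds the Laplace transform of ρ from below uniformly; x = y^(1/a) makes x^a = y
  -- arbitrarily large.
  have hle : ∀ y : ℝ, 0 < y → (1 + y) * ρ.real {0} ≤ 1 := fun y hy => by
    have hx : 0 ≤ y ^ (1 / a) := by positivity
    have h := H _ hx
    rw [← Real.rpow_mul hy.le, one_div_mul_cancel ha₀.ne', Real.rpow_one] at h
    refine le_of_le_of_eq (mul_le_mul_of_nonneg_left ?_ (by positivity)) h
    have he : IntegrableOn (fun t : ℝ => Real.exp (-(1 * t))) (Ioi 0) := by
      simpa only [neg_mul] using exp_neg_integrableOn_Ioi 0 one_pos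
    have h1 : ∫ t in Ioi (0 : ℝ), Real.exp (-(1 * t)) * ρ.real {0} = ρ.real {0} := by
      rw [integral_mul_const]
      simp only [one_mul, integral_exp_neg_Ioi_zero]
    calc _ = ∫ t in Ioi (0 : ℝ), Real.exp (-(1 * t)) * ρ.real {0} := h1.symm
      _ ≤ _ := setIntegral_mono_on (he.mul_const _)
          (integrableOn_exp_neg_mul_mgf hρ hb hx one_pos) measurableSet_Ioi fun t ht =>
          mul_le_mul_of_nonneg_left (measureReal_singleton_zero_le_mgf hρ
            (mul_nonneg hx (Real.rpow_nonneg (le_of_lt ht) _))) (Real.exp_nonneg _)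
  have h0 : ρ.real {0} = 0 := by
    by_contra hne
    have hpos : 0 < ρ.real {0} := lt_of_le_of_ne measureReal_nonneg (Ne.symm hne)
    -- With y the inverse mass m⁻¹ of the atom, the bound reads m + 1 ≤ 1.
    have := hle (1 / ρ.real {0}) (by positivity)
    rw [add_mul, one_div_mul_cancel hne] at this
    linarith
  exact (measureReal_eq_zero_iff).1 h0

end LaplaceOfLaw

/-! ### Laws of √Λ • V for independent Λ and V. -/

section Mixture

variable {Ω : Type*} [MeasurableSpace Ω] {P : Measure Ω} [IsProbabilityMeasure P] {Λ : Ω → ℝ}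
  {E : Type*} [NormedAddCommGroup E] [NormedSpace ℝ E] [MeasurableSpace E] [BorelSpace E]
  [SecondCountableTopology E] {V V' : Ω → E}

theorem map_sqrt_smul_eq (hΛ : AEMeasurable Λ P) (hV : AEMeasurable V P)
    (hind : IndepFun Λ V P) :
    P.map (fun ω => Real.sqrt (Λ ω) • V ω)
      = ((P.map Λ).prod (P.map V)).map (fun p : ℝ × E => Real.sqrt p.1 • p.2) := by
  rw [← (indepFun_iff_map_prod_eq_prod_map_map hΛ hV).1 hind,
    AEMeasurable.map_map_of_aemeasurable (by fun_prop) (hΛ.prodMk hV)]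
  rfl

/-- The law of `√Λ • V` is a mixture of scalings of the law of `V`. -/
theorem map_sqrt_smul_apply (hΛ : AEMeasurable Λ P) (hV : AEMeasurable V P)
    (hind : IndepFun Λ V P) {B : Set E} (hB : MeasurableSet B) :
    P.map (fun ω => Real.sqrt (Λ ω) • V ω) B
      = ∫⁻ l, (P.map V).map (fun v => Real.sqrt l • v) B ∂(P.map Λ) := by
  have hm : Measurable (fun p : ℝ × E => Real.sqrt p.1 • p.2) := by fun_prop
  have := Measure.isProbabilityMeasure_map hV
  rw [map_sqrt_smul_eq hΛ hV hind, Measure.map_apply hm hB, Measure.prod_apply (hm hB)]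
  refine lintegral_congr fun l => ?_
  rw [Measure.map_apply (by fun_prop) hB]
  rfl

/-- By independence the product law depends only on the two marginals; this carries identities in
law from G to √Λ G. -/
theorem map_sqrt_smul_congr (hΛ : AEMeasurable Λ P) (hV : AEMeasurable V P)
    (hV' : AEMeasurable V' P) (hind : IndepFun Λ V P) (hind' : IndepFun Λ V' P)
    (h : P.map V = P.map V') :
    P.map (fun ω => Real.sqrt (Λ ω) • V ω) = P.map (fun ω => Real.sqrt (Λ ω) • V' ω) := by
  rw [map_sqrt_smul_eq hΛ hV hind, map_sqrt_smul_eq hΛ hV' hind', h]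

/-- If almost every component of the mixture has a density, so does the mixture. -/
theorem map_sqrt_smul_eq_withDensity (hΛ : AEMeasurable Λ P)
    (hV : AEMeasurable V P) (hind : IndepFun Λ V P) {m : Measure E} [SFinite m]
    {f : ℝ → E → ℝ≥0∞} (hf : Measurable (Function.uncurry f))
    (hd : ∀ᵐ l ∂(P.map Λ), (P.map V).map (fun v => Real.sqrt l • v) = m.withDensity (f l)) :
    P.map (fun ω => Real.sqrt (Λ ω) • V ω)
      = m.withDensity (fun x => ∫⁻ l, f l x ∂(P.map Λ)) := by
  have := Measure.isProbabilityMeasure_map hΛ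
  ext B hB
  rw [map_sqrt_smul_apply hΛ hV hind hB, withDensity_apply _ hB,
    lintegral_lintegral_swap (by exact (hf.comp measurable_swap).aemeasurable)]
  refine lintegral_congr_ae ?_
  filter_upwards [hd] with l hl
  rw [hl, withDensity_apply _ hB]

end Mixture

/-! ### Self-similarity and stationary increments. -/

section HSSSI

variable {Ω : Type*} [MeasurableSpace Ω] {P : Measure Ω} [IsProbabilityMeasure P] {Λ : Ω → ℝ}
  {G : ℝ≥0 → Ω → ℝ}

/-- Multiplication by an independent factor preserves the H-SSSI property. -/
theorem IsHSSSI.sqrt_mul_of_indepFun {H : ℝ} (hG : IsHSSSI H G P) (hΛ : AEMeasurable Λ P)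
    (hind : IndepFun Λ (fun ω t => G t ω) P) : IsHSSSI H (scaleMixtureProcess Λ G) P := by
  have hm := hG.aemeasurable
  have hind' : ∀ {n : ℕ} (φ : (ℝ≥0 → ℝ) → Fin n → ℝ), Measurable φ →
      IndepFun Λ (fun ω => φ fun t => G t ω) P := fun φ hφ =>
    hind.comp measurable_id hφ
  refine ⟨fun t => ?_, fun a ha n t => ?_, fun s n t τ => ?_⟩
  · unfold STFD.scaleMixtureProcess
    exact hΛ.sqrt.mul (hm t)
  · have h := map_sqrt_smul_congr (V := fun ω i => G (a * t i) ω)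
      (V' := fun ω i => (a : ℝ) ^ H * G (t i) ω) hΛ
      (aemeasurable_pi_lambda _ fun i => hm _)
      (aemeasurable_pi_lambda _ fun i => (hm _).const_mul _)
      (hind' (fun g i => g (a * t i)) (by fun_prop))
      (hind' (fun g i => (a : ℝ) ^ H * g (t i)) (by fun_prop))
      (hG.selfSimilar a ha n t)
    refine Eq.trans h ?_
    congr 1
    ext ω i
    simp only [STFD.scaleMixtureProcess, Pi.smul_apply, smul_eq_mul]
    ring
  · have h := map_sqrt_smul_congr (V := fun ω i => G (t i + τ i + s) ω - G (t i + s) ω)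
      (V' := fun ω i => G (t i + τ i) ω - G (t i) ω) hΛ
      (aemeasurable_pi_lambda _ fun i => (hm _).sub (hm _))
      (aemeasurable_pi_lambda _ fun i => (hm _).sub (hm _))
      (hind' (fun g i => g (t i + τ i + s) - g (t i + s)) (by fun_prop))
      (hind' (fun g i => g (t i + τ i) - g (t i)) (by fun_prop))
      (hG.stationaryIncrements s n t τ)
    convert h using 2 <;>
    · ext ω i
      simp only [STFD.scaleMixtureProcess, Pi.smul_apply, smul_eq_mul]
      ring

end HSSSI

/-! ### One-time laws: characteristic function, density and decay. -/

section OneTime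

variable {Ω : Type*} [MeasurableSpace Ω] {P : Measure Ω} [IsProbabilityMeasure P] {Λ : Ω → ℝ}

/-- The characteristic function of `√Λ · N` for a centred Gaussian `N` of variance `2v`. -/
theorem charFun_map_sqrt_mul {N : Ω → ℝ} (hΛ : AEMeasurable Λ P) (hΛ₀ : ∀ᵐ ω ∂P, 0 ≤ Λ ω)
    (hN : AEMeasurable N P) (hind : IndepFun Λ N P) {v : ℝ} (hv : 0 ≤ v)
    (hlaw : P.map N = gaussianReal 0 (2 * v).toNNReal) (κ : ℝ) :
    charFun (P.map fun ω => Real.sqrt (Λ ω) * N ω) κ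
      = ((mgf id (P.map Λ) (-(κ ^ 2 * v)) : ℝ) : ℂ) := by
  have := Measure.isProbabilityMeasure_map hΛ
  have := Measure.isProbabilityMeasure_map hN
  have h := map_sqrt_smul_eq hΛ hN hind
  simp only [smul_eq_mul] at h
  -- Fubini conditions on Λ = l, leaving the Gaussian characteristic function at κ√l, that is
  -- exp(-κ² v l).
  rw [h, charFun_apply_real, integral_map (by fun_prop) (by fun_prop), integral_prod]
  · rw [mgf, ← integral_complex_ofReal]
    have hρ : ∀ᵐ l ∂(P.map Λ), 0 ≤ l := by
      rwa [ae_map_iff hΛ measurableSet_Ici]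
    refine integral_congr_ae ?_
    filter_upwards [hρ] with l hl
    have e : ∀ g : ℝ, Complex.exp (κ * ((Real.sqrt l * g : ℝ) : ℂ) * Complex.I)
        = Complex.exp (((κ * Real.sqrt l : ℝ) : ℂ) * (g : ℂ) * Complex.I) := fun g => by
      push_cast; ring_nf
    simp only [e]
    rw [← charFun_apply_real, hlaw, charFun_gaussianReal, Real.coe_toNNReal _ (by positivity),
      id, Complex.ofReal_exp]
    congr 1
    have hs : ((Real.sqrt l : ℝ) : ℂ) ^ 2 = l := by
      rw [← Complex.ofReal_pow, Real.sq_sqrt hl]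
    push_cast
    rw [mul_pow, hs]
    ring
  · refine Integrable.of_bound (by fun_prop) 1 (Eventually.of_forall fun p => ?_)
    rw [← Complex.ofReal_mul, Complex.norm_exp_ofReal_mul_I]

theorem gaussKernel_eq_gaussianPDFReal {ξ : ℝ} (hξ : 0 ≤ ξ) (x : ℝ) :
    gaussKernel x ξ = gaussianPDFReal 0 (2 * ξ).toNNReal x := by
  rw [gaussKernel, gaussianPDFReal, Real.coe_toNNReal _ (by positivity), div_eq_inv_mul]
  congr 2
  · congr 1; ring
  · rw [sub_zero, neg_div]; congr 2; ring

/-- A bound uniform in ξ makes every mixture by a finite measure vanish at infinity, with no moment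
condition. With u = x²/(4ξ), it follows from e^(2u) ≥ 1 + 2u; for ξ ≤ 0 the kernel is 0 by the
conventions for `Real.sqrt` and division. -/
theorem gaussKernel_le {x : ℝ} (hx : x ≠ 0) (ξ : ℝ) : gaussKernel x ξ ≤ 1 / |x| := by
  have hx' : 0 < |x| := abs_pos.2 hx
  rcases le_or_gt ξ 0 with hξ | hξ
  · have : Real.sqrt (4 * Real.pi * ξ) = 0 := by
      refine Real.sqrt_eq_zero_of_nonpos ?_
      nlinarith [Real.pi_pos]
    rw [gaussKernel, this, div_zero]
    positivity
  · have hπ := Real.pi_pos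
    rw [gaussKernel, div_le_div_iff₀ (by positivity) hx', one_mul]
    have hexp : 1 + x ^ 2 / (4 * ξ) * 2 ≤ Real.exp (x ^ 2 / (4 * ξ)) ^ 2 := by
      rw [← Real.exp_nat_mul]
      have := Real.add_one_le_exp (((2 : ℕ) : ℝ) * (x ^ 2 / (4 * ξ)))
      push_cast at this ⊢
      linarith
    have hkey : |x| ≤ Real.sqrt (4 * Real.pi * ξ) * Real.exp (x ^ 2 / (4 * ξ)) := by
      refine abs_le_of_sq_le_sq ?_ (by positivity)
      rw [mul_pow, Real.sq_sqrt (by positivity)]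
      calc x ^ 2 ≤ 4 * Real.pi * ξ * (1 + x ^ 2 / (4 * ξ) * 2) := by
            have e : 4 * Real.pi * ξ * (1 + x ^ 2 / (4 * ξ) * 2)
                = 4 * Real.pi * ξ + 2 * Real.pi * x ^ 2 := by field_simp
            rw [e]
            nlinarith [Real.pi_gt_three, sq_nonneg x, mul_pos hπ hξ]
        _ ≤ _ := by gcongr
    rw [Real.exp_neg, inv_mul_le_iff₀ (Real.exp_pos _), mul_comm]
    exact hkey

theorem tendsto_lintegral_gaussKernel (μ : Measure ℝ) [IsFiniteMeasure μ] :
    Tendsto (fun x : ℝ => ∫⁻ ξ, ENNReal.ofReal (gaussKernel x ξ) ∂μ) (cocompact ℝ) (𝓝 0) := by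
  have hlim : Tendsto (fun x : ℝ => ENNReal.ofReal (1 / |x|) * μ univ) (cocompact ℝ) (𝓝 0) := by
    have h1 : Tendsto (fun x : ℝ => 1 / |x|) (cocompact ℝ) (𝓝 0) := by
      simpa only [one_div] using! tendsto_inv_atTop_zero.comp (tendsto_norm_cocompact_atTop (E := ℝ))
    have h2 := ENNReal.tendsto_ofReal h1
    have h3 := ENNReal.Tendsto.mul_const (b := μ univ) h2 (Or.inr (measure_ne_top _ _))
    simpa using h3
  refine tendsto_of_tendsto_of_tendsto_of_le_of_le' tendsto_const_nhds hlim
    (Eventually.of_forall fun _ => zero_le) ?_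
  have h0 : ∀ᶠ x : ℝ in cocompact ℝ, x ≠ 0 := by
    have := (tendsto_norm_cocompact_atTop (E := ℝ)).eventually (eventually_gt_atTop 0)
    filter_upwards [this] with x hx
    exact norm_pos_iff.1 hx
  filter_upwards [h0] with x hx
  calc _ ≤ ∫⁻ _, ENNReal.ofReal (1 / |x|) ∂μ :=
        lintegral_mono fun ξ => ENNReal.ofReal_le_ofReal (gaussKernel_le hx ξ)
    _ = _ := by rw [lintegral_const]

theorem gaussianReal_map_sqrt_mul_eq_withDensity {v l : ℝ} (hv : 0 < v) (hl : 0 < l) :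
    (gaussianReal 0 (2 * v).toNNReal).map (fun x => Real.sqrt l * x)
      = volume.withDensity fun x => ENNReal.ofReal (gaussKernel x (v * l)) := by
  have hvl : 0 < v * l := mul_pos hv hl
  have hne : (2 * (v * l)).toNNReal ≠ 0 := by
    rw [Ne, Real.toNNReal_eq_zero, not_le]; positivity
  have e : (.mk (Real.sqrt l ^ 2) (sq_nonneg _) : ℝ≥0) * (2 * v).toNNReal
      = (2 * (v * l)).toNNReal := by
    refine NNReal.eq ?_
    rw [NNReal.coe_mul, NNReal.coe_mk, Real.coe_toNNReal _ (by positivity),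
      Real.coe_toNNReal _ (by positivity), Real.sq_sqrt hl.le]
    ring
  rw [gaussianReal_map_const_mul, mul_zero, e, gaussianReal_of_var_ne_zero _ hne]
  simp_rw [gaussKernel_eq_gaussianPDFReal hvl.le]
  rfl

/-- The density of `√Λ · N` for a centred Gaussian `N` of variance `2v`. -/
theorem map_sqrt_mul_eq_withDensity {N : Ω → ℝ} (hΛ : AEMeasurable Λ P)
    (hΛ₀ : ∀ᵐ l ∂(P.map Λ), 0 < l) (hN : AEMeasurable N P) (hind : IndepFun Λ N P) {v : ℝ}
    (hv : 0 < v) (hlaw : P.map N = gaussianReal 0 (2 * v).toNNReal) :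
    P.map (fun ω => Real.sqrt (Λ ω) * N ω) = volume.withDensity fun x =>
      ∫⁻ ξ, ENNReal.ofReal (gaussKernel x ξ) ∂((P.map Λ).map fun l => v * l) := by
  have hmeas : ∀ x, Measurable fun ξ => ENNReal.ofReal (gaussKernel x ξ) := fun x => by
    unfold gaussKernel
    fun_prop
  have hmeas' : Measurable (Function.uncurry fun l x => ENNReal.ofReal (gaussKernel x (v * l))) := by
    unfold gaussKernel Function.uncurry
    fun_prop
  have h := map_sqrt_smul_eq_withDensity (V := N) (m := volume) hΛ hN hind hmeas' ?_
  · simp only [smul_eq_mul] at h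
    rw [h]
    refine withDensity_congr_ae (Eventually.of_forall fun x => ?_)
    exact (lintegral_map (hmeas x) (measurable_const_mul v)).symm
  · filter_upwards [hΛ₀] with l hl
    rw [hlaw]
    exact gaussianReal_map_sqrt_mul_eq_withDensity hv hl

end OneTime

/-! ### Densities of Gaussian vectors and the vectors of a Gaussian process. -/

section Multivariate

theorem map_withDensity_comp {X Y : Type*} [MeasurableSpace X] [MeasurableSpace Y] (m : Measure X)
    {f : X → Y} (hf : Measurable f) {h : Y → ℝ≥0∞} (hh : Measurable h) :
    (m.withDensity (fun x => h (f x))).map f = (m.map f).withDensity h := by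
  ext B hB
  rw [Measure.map_apply hf hB, withDensity_apply _ (hf hB), withDensity_apply _ hB,
    setLIntegral_map hB hh hf]

variable {n : ℕ}

theorem integrable_exp_neg_norm_sq_div_two :
    Integrable fun x : EuclideanSpace ℝ (Fin n) => Real.exp (-(1 / 2) * ‖x‖ ^ 2) := by
  have h := GaussianFourier.integrable_cexp_neg_mul_sq_norm_add
    (V := EuclideanSpace ℝ (Fin n)) (b := 1 / 2) (by norm_num) 0 0
  refine h.norm.congr (Eventually.of_forall fun x => ?_)
  simp only [zero_mul, add_zero]
  rw [show (-(1 / 2 : ℂ) * (‖x‖ : ℂ) ^ 2) = ((-(1 / 2) * ‖x‖ ^ 2 : ℝ) : ℂ) by push_cast; ring,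
    Complex.norm_exp_ofReal]

/-- Both sides have the same characteristic function: the Gaussian Fourier integral with b = 1/2
yields (2π)^(n/2), which cancels the normalisation. -/
theorem stdGaussian_eq_withDensity :
    stdGaussian (EuclideanSpace ℝ (Fin n)) = volume.withDensity fun x =>
      ENNReal.ofReal ((Real.sqrt ((2 * Real.pi) ^ n))⁻¹ * Real.exp (-(1 / 2) * ‖x‖ ^ 2)) := by
  have hi := (integrable_exp_neg_norm_sq_div_two (n := n)).const_mul
    (Real.sqrt ((2 * Real.pi) ^ n))⁻¹
  have := isFiniteMeasure_withDensity_ofReal hi.2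
  refine Measure.ext_of_charFun (funext fun t => ?_)
  rw [charFun_stdGaussian, charFun_apply, integral_withDensity_eq_integral_toReal_smul
    (by fun_prop) (Eventually.of_forall fun _ => ENNReal.ofReal_lt_top)]
  have hr : ∀ x : EuclideanSpace ℝ (Fin n),
      0 ≤ (Real.sqrt ((2 * Real.pi) ^ n))⁻¹ * Real.exp (-(1 / 2) * ‖x‖ ^ 2) := fun x => by
    positivity
  have e : ∀ x : EuclideanSpace ℝ (Fin n),
      (ENNReal.ofReal ((Real.sqrt ((2 * Real.pi) ^ n))⁻¹ *
        Real.exp (-(1 / 2) * ‖x‖ ^ 2))).toReal • Complex.exp (inner ℝ x t * Complex.I)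
      = (((Real.sqrt ((2 * Real.pi) ^ n))⁻¹ : ℝ) : ℂ) *
        Complex.exp (-(1 / 2 : ℂ) * (‖x‖ : ℂ) ^ 2 + Complex.I * (inner ℝ t x : ℝ)) := fun x => by
    rw [ENNReal.toReal_ofReal (hr x), Complex.real_smul, Complex.exp_add, real_inner_comm]
    push_cast
    ring_nf
  simp_rw [e]
  rw [integral_const_mul, GaussianFourier.integral_cexp_neg_mul_sq_norm_add (by norm_num),
    finrank_euclideanSpace_fin]
  have hc : ((Real.pi : ℂ) / (1 / 2 : ℂ)) ^ ((n : ℂ) / 2)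
      = ((Real.sqrt ((2 * Real.pi) ^ n) : ℝ) : ℂ) := by
    rw [show (Real.pi : ℂ) / (1 / 2 : ℂ) = ((2 * Real.pi : ℝ) : ℂ) by push_cast; ring,
      show (n : ℂ) / 2 = ((n / 2 : ℝ) : ℂ) by push_cast; ring,
      ← Complex.ofReal_cpow (by positivity), Real.sqrt_eq_rpow, ← Real.rpow_natCast,
      ← Real.rpow_mul (by positivity)]
    congr 2; ring
  have hne : ((Real.sqrt ((2 * Real.pi) ^ n) : ℝ) : ℂ) ≠ 0 := by
    have : 0 < Real.sqrt ((2 * Real.pi) ^ n) := by positivity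
    exact_mod_cast this.ne'
  rw [hc, Complex.ofReal_inv, inv_mul_cancel_left₀ hne, Complex.I_sq]
  congr 1; ring

theorem measurable_gaussVectorDensity (γ : Matrix (Fin n) (Fin n) ℝ) :
    Measurable (Function.uncurry (gaussVectorDensity γ)) := by
  have hq : Continuous fun x : EuclideanSpace ℝ (Fin n) => x.ofLp ⬝ᵥ (γ⁻¹ *ᵥ x.ofLp) := by
    fun_prop
  have hq' := hq.measurable
  unfold gaussVectorDensity Function.uncurry
  have : Measurable fun p : ℝ × EuclideanSpace ℝ (Fin n) =>
    p.2.ofLp ⬝ᵥ (γ⁻¹ *ᵥ p.2.ofLp) := hq'.comp measurable_snd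
  fun_prop

theorem gaussVectorDensity_smul (γ : Matrix (Fin n) (Fin n) ℝ) {l : ℝ} (hl : 0 < l) :
    gaussVectorDensity (l • γ) 1 = gaussVectorDensity γ l := by
  have hinv : (l • γ)⁻¹ = l⁻¹ • γ⁻¹ := by
    by_cases h : IsUnit γ.det
    · have := Matrix.inv_smul' γ (Units.mk0 l hl.ne') h
      simpa [Units.smul_def] using this
    -- For singular γ both matrix inverses are 0 by convention, so the identity persists.
    · have h' : ¬ IsUnit (l • γ).det := by
        rw [Matrix.det_smul, isUnit_iff_ne_zero] at *
        simpa [hl.ne'] using h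
      rw [Matrix.nonsing_inv_apply_not_isUnit _ h, Matrix.nonsing_inv_apply_not_isUnit _ h',
        smul_zero]
  ext x
  unfold gaussVectorDensity
  rw [hinv, Matrix.det_smul, Fintype.card_fin, Matrix.smul_mulVec, dotProduct_smul, smul_eq_mul]
  congr 2
  · congr 1; rw [mul_one, mul_pow, mul_pow]; ring
  · field_simp

-- Change of variables along A = √S: A S⁻¹ A = 1 turns the quadratic form into ‖x‖², and the
-- Jacobian |det A|⁻¹ equals (det S)^(-1/2).
open scoped MatrixOrder in
theorem multivariateGaussian_eq_withDensity {S : Matrix (Fin n) (Fin n) ℝ} (hS : S.PosSemidef)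
    (hdet : S.det ≠ 0) :
    multivariateGaussian 0 S = volume.withDensity fun x =>
      ENNReal.ofReal (gaussVectorDensity S 1 x) := by
  set A := CFC.sqrt S with hA
  have hAA : A * A = S := CFC.sqrt_mul_sqrt_self _ hS.nonneg
  have hAsymm : Aᵀ = A := by
    have : IsSelfAdjoint A := (CFC.sqrt_nonneg S).isSelfAdjoint
    have h2 : Aᴴ = A := this
    simpa [Matrix.conjTranspose_eq_transpose_of_trivial] using h2
  have hAdet : A.det ≠ 0 := fun h => hdet (by rw [← hAA, Matrix.det_mul, h, zero_mul])
  have hAu : IsUnit A.det := isUnit_iff_ne_zero.2 hAdet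
  have hASA : A * (S⁻¹ * A) = 1 := by
    rw [← hAA, Matrix.mul_inv_rev, Matrix.mul_assoc A⁻¹, Matrix.nonsing_inv_mul _ hAu,
      Matrix.mul_one, Matrix.mul_nonsing_inv _ hAu]
  set T : EuclideanSpace ℝ (Fin n) →L[ℝ] EuclideanSpace ℝ (Fin n) :=
    toEuclideanCLM (𝕜 := ℝ) A with hT
  have hTdet : LinearMap.det (T : EuclideanSpace ℝ (Fin n) →ₗ[ℝ] EuclideanSpace ℝ (Fin n))
      = A.det := by
    rw [hT, coe_toEuclideanCLM_eq_toEuclideanLin, Matrix.toEuclideanLin, Matrix.toLpLin_eq_toLin,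
      LinearMap.det_toLin]
  set h : EuclideanSpace ℝ (Fin n) → ℝ≥0∞ := fun y =>
    ENNReal.ofReal ((Real.sqrt ((2 * Real.pi) ^ n))⁻¹ *
      Real.exp (-(1 / 2) * (y.ofLp ⬝ᵥ (S⁻¹ *ᵥ y.ofLp)))) with hh
  have hq : Continuous fun x : EuclideanSpace ℝ (Fin n) => x.ofLp ⬝ᵥ (S⁻¹ *ᵥ x.ofLp) := by
    fun_prop
  have hhm : Measurable h := by
    have := hq.measurable
    fun_prop
  have hhT : ∀ x : EuclideanSpace ℝ (Fin n),
      ENNReal.ofReal ((Real.sqrt ((2 * Real.pi) ^ n))⁻¹ * Real.exp (-(1 / 2) * ‖x‖ ^ 2))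
        = h (T x) := fun x => by
    have e : (T x).ofLp ⬝ᵥ (S⁻¹ *ᵥ (T x).ofLp) = ‖x‖ ^ 2 := by
      rw [hT, ofLp_toEuclideanCLM, Matrix.mulVec_mulVec, dotProduct_comm,
        Matrix.dotProduct_mulVec, ← Matrix.mulVec_transpose, hAsymm, Matrix.mulVec_mulVec, hASA,
        Matrix.one_mulVec, EuclideanSpace.real_norm_sq_eq]
      simp [dotProduct, sq]
    simp only [hh, e]
  have hmap : (volume : Measure (EuclideanSpace ℝ (Fin n))).map T
      = ENNReal.ofReal |A.det⁻¹| • volume := by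
    have := Measure.map_linearMap_addHaar_eq_smul_addHaar
      (volume : Measure (EuclideanSpace ℝ (Fin n))) (f := (T : _ →ₗ[ℝ] _)) (by rwa [hTdet])
    rwa [hTdet] at this
  rw [multivariateGaussian]
  simp only [zero_add]
  rw [stdGaussian_eq_withDensity]
  simp_rw [hhT]
  rw [map_withDensity_comp _ T.continuous.measurable hhm, hmap, withDensity_smul_measure,
    ← withDensity_smul _ hhm]
  congr 1
  ext y
  rw [Pi.smul_apply, smul_eq_mul, hh, ← ENNReal.ofReal_mul (abs_nonneg _), gaussVectorDensity,
    ← mul_assoc]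
  congr 3
  swap
  · norm_num
  rw [← hAA, Matrix.det_mul, mul_one, Real.sqrt_mul (by positivity), Real.sqrt_mul_self_eq_abs,
    mul_inv, abs_inv, mul_comm]

theorem map_smul_multivariateGaussian {γ : Matrix (Fin n) (Fin n) ℝ} (hγ : γ.PosSemidef) {l : ℝ}
    (hl : 0 ≤ l) :
    (multivariateGaussian 0 γ).map (fun v => Real.sqrt l • v) = multivariateGaussian 0 (l • γ) := by
  refine Measure.ext_of_charFun (funext fun x => ?_)
  rw [charFun_map_smul, charFun_multivariateGaussian hγ,
    charFun_multivariateGaussian (hγ.smul hl)]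
  simp only [inner_zero_right, Complex.ofReal_zero, zero_mul, zero_sub, WithLp.ofLp_smul,
    Matrix.mulVec_smul, Matrix.smul_mulVec, dotProduct_smul, smul_dotProduct, smul_eq_mul]
  rw [← mul_assoc, Real.mul_self_sqrt hl]

variable {Ω : Type*} [MeasurableSpace Ω] {P : Measure Ω} {G : ℝ≥0 → Ω → ℝ}

theorem hasGaussianLaw_timeVector (hG : IsGaussianProcess G P) (t : Fin n → ℝ≥0) :
    HasGaussianLaw (timeVector G t) P := by
  let L : (↥(Finset.univ : Finset (Fin n)) → ℝ) →L[ℝ] Fin n → ℝ :=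
    { toFun := fun x i => x ⟨i, Finset.mem_univ i⟩
      map_add' := fun x y => by ext; simp
      map_smul' := fun m x => by ext; simp }
  -- Times may repeat, so the process is first reindexed by `Fin n` before a finite set of indices
  -- is taken.
  have h := ((hG.comp_right t).hasGaussianLaw Finset.univ).map L
  exact HasGaussianLaw.toLp_pi (X := fun i => G (t i)) 2 h

theorem posSemidef_covMatrix [IsProbabilityMeasure P] (hG : IsGaussianProcess G P)
    (t : Fin n → ℝ≥0) : (covMatrix G P t).PosSemidef := by
  refine Matrix.PosSemidef.of_dotProduct_mulVec_nonneg ?_ fun x => ?_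
  · ext i j
    simp [covMatrix, covariance_comm]
  · have h := covarianceBilin_apply_pi (μ := P) (X := fun i => G (t i))
      (fun i => (hG.hasGaussianLaw_eval (t i)).memLp_two) (WithLp.toLp 2 x) (WithLp.toLp 2 x)
    have hn := (isPosSemidef_covarianceBilin
      (μ := P.map (fun ω => WithLp.toLp 2 (fun i => G (t i) ω)))).nonneg (WithLp.toLp 2 x)
    rw [ContinuousLinearMap.toBilinForm_apply, h] at hn
    refine hn.trans_eq ?_
    simp only [dotProduct, Matrix.mulVec, covMatrix, Matrix.of_apply, Finset.mul_sum, star_trivial]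
    refine Finset.sum_congr rfl fun i _ => Finset.sum_congr rfl fun j _ => ?_
    ring

theorem map_timeVector_eq_multivariateGaussian [IsProbabilityMeasure P]
    (hG : IsGaussianProcess G P) (hGmean : ∀ t, ∫ ω, G t ω ∂P = 0) (t : Fin n → ℝ≥0) :
    P.map (timeVector G t) = multivariateGaussian 0 (covMatrix G P t) := by
  have hS := posSemidef_covMatrix hG t
  have hL := hasGaussianLaw_timeVector hG t
  have := hL.isGaussian_map
  refine IsGaussian.ext ?_ ?_
  · rw [integral_id_multivariateGaussian', integral_map hL.aemeasurable (by fun_prop)]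
    ext i
    have h := (EuclideanSpace.proj (𝕜 := ℝ) i).integral_comp_comm hL.integrable
    simp only [EuclideanSpace.coe_proj] at h
    simp only [id]
    rw [← h]
    simp [timeVector, hGmean]
  · ext x y
    rw [covarianceBilin_multivariateGaussian hS]
    have h := covarianceBilin_apply_pi (μ := P) (X := fun i => G (t i))
      (fun i => (hG.hasGaussianLaw_eval (t i)).memLp_two) x y
    refine h.trans ?_
    simp only [dotProduct, Matrix.mulVec, covMatrix, Matrix.of_apply, Finset.mul_sum]
    refine Finset.sum_congr rfl fun i _ => Finset.sum_congr rfl fun j _ => ?_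
    ring

end Multivariate

/-! ### The symmetric equation solved by Gaussian mixtures. -/

section Subordination

variable {α β : ℝ} {ρ : Measure ℝ} [IsProbabilityMeasure ρ]

/-- The resolvent equation on the positive real axis for the law at time `1` of the fundamental
solution of extremal asymmetry. -/
theorem IsFundamentalSolution.resolvent_mgf {a β : ℝ} (ha₀ : 0 < a) (ha₁ : a ≤ 1)
    {F : ℝ≥0 → Measure ℝ} (hF : IsFundamentalSolution a β (-a) F) (h1 : F 1 = ρ)
    (hρ : ∀ᵐ l ∂ρ, 0 ≤ l) {s : ℝ} (hs : 0 < s) {x : ℝ} (hx : 0 ≤ x) :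
    (s ^ β + x ^ a) *
      ∫ t in Ioi (0 : ℝ), Real.exp (-(s * t)) * mgf id ρ (-(x * t ^ (β / a))) = s ^ (β - 1) := by
  refine resolvent_mgf_of_resolvent_charFun hρ ha₀ ha₁ hs (fun κ => ?_) hx
  rw [← hF.resolvent κ hs]
  congr 1
  refine setIntegral_congr_fun measurableSet_Ioi fun t ht => ?_
  rw [hF.charFun_scaling ha₀ (rieszFellerSymbol_neg_re_nonpos ha₀ ha₁) κ ht, h1]

/-- A family of Gaussian variance mixtures whose mixing law satisfies the resolvent equation is a
fundamental solution of the symmetric equation. -/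
theorem isFundamentalSolution_of_charFun_eq_mgf (hα : 0 < α) (hβ : 0 < β)
    (hρ : ∀ᵐ l ∂ρ, 0 ≤ l)
    (hres : ∀ s : ℝ, 0 < s → ∀ x : ℝ, 0 ≤ x → (s ^ β + x ^ (α / 2)) *
      ∫ t in Ioi (0 : ℝ), Real.exp (-(s * t)) * mgf id ρ (-(x * t ^ (2 * β / α))) = s ^ (β - 1))
    {K : ℝ≥0 → Measure ℝ} (hfin : ∀ t, IsFiniteMeasure (K t))
    (hK : ∀ t κ, charFun (K t) κ = ((mgf id ρ (-(κ ^ 2 * (t : ℝ) ^ (2 * β / α))) : ℝ) : ℂ)) :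
    IsFundamentalSolution α β 0 K := by
  have hb : 0 < 2 * β / α := by positivity
  have hK0 : ∀ κ, charFun (K 0) κ = 1 := fun κ => by
    rw [hK, NNReal.coe_zero, Real.zero_rpow hb.ne']
    simp
  refine ⟨hfin, ?_, fun κ => ?_⟩
  · have := hfin 0
    refine Measure.ext_of_charFun (funext fun κ => ?_)
    rw [hK0]; simp
  · have hKt : ∀ t : ℝ, 0 ≤ t → charFun (K t.toNNReal) κ
        = ((mgf id ρ (-(κ ^ 2 * t ^ (2 * β / α))) : ℝ) : ℂ) := fun t ht => by
      rw [hK, Real.coe_toNNReal t ht]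
    have heq : ∀ s : ℝ, EqOn (fun t : ℝ => (Real.exp (-(s * t)) : ℂ) * charFun (K t.toNNReal) κ)
        (fun t => ((Real.exp (-(s * t)) * mgf id ρ (-(κ ^ 2 * t ^ (2 * β / α))) : ℝ) : ℂ))
        (Ioi 0) := fun s t ht => by
      simp only
      rw [hKt t (le_of_lt ht), Complex.ofReal_mul]
    have hint : ∀ s : ℝ, 0 < s → IntegrableOn
        (fun t : ℝ => (Real.exp (-(s * t)) : ℂ) * charFun (K t.toNNReal) κ) (Ioi 0) := fun s hs =>
      IntegrableOn.congr_fun (integrableOn_exp_neg_mul_mgf hρ hb (sq_nonneg κ) hs).ofReal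
        (heq s).symm measurableSet_Ioi
    refine ⟨?_, hint, fun s hs => ?_, fun s hs => ?_⟩
    · have hc : ContinuousOn (fun t : ℝ => mgf id ρ (-(κ ^ 2 * t ^ (2 * β / α)))) (Ici 0) := by
        refine (continuousOn_mgf_neg hρ).comp (f := fun t : ℝ => κ ^ 2 * t ^ (2 * β / α)) ?_ ?_
        · exact (continuous_const.mul (Real.continuous_rpow_const hb.le)).continuousOn
        · intro t ht
          exact mul_nonneg (sq_nonneg κ) (Real.rpow_nonneg ht _)
      exact (Complex.continuous_ofReal.comp_continuousOn hc).congr fun t ht => hKt t ht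
    · simp only [rieszFellerDerivFourier]
      simp_rw [mul_left_comm _ (rieszFellerSymbol α 0 κ)]
      exact (hint s hs).const_mul _
    · simp only [rieszFellerDerivFourier]
      simp_rw [mul_left_comm _ (rieszFellerSymbol α 0 κ)]
      -- The choice x = κ² turns x^(α/2) into |κ|^α, minus the symmetric symbol.
      have hr := hres s hs (κ ^ 2) (sq_nonneg κ)
      have hκ : (κ ^ 2) ^ (α / 2) = |κ| ^ α := by
        rw [← sq_abs, ← Real.rpow_natCast, ← Real.rpow_mul (abs_nonneg κ)]
        congr 1; push_cast; ring
      rw [hκ] at hr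
      rw [integral_const_mul, setIntegral_congr_fun measurableSet_Ioi (heq s),
        integral_complex_ofReal, rieszFellerSymbol_symm, Real.toNNReal_zero, hK0, ← hr]
      push_cast
      ring

end Subordination

end STFD

/-! ### The stochastic solution. -/

theorem mainTheorem3 (α β : ℝ) (hα₀ : 0 < α) (hα₂ : α ≤ 2) (hβ₀ : 0 < β) (hβ₁ : β ≤ 1)
    {Ω : Type*} [MeasurableSpace Ω] (P : Measure Ω) [IsProbabilityMeasure P]
    (G : ℝ≥0 → Ω → ℝ) (Λ : Ω → ℝ)
    -- `G` is a centred Gaussian process with variance `2 t^{2β/α}`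
    (hG : IsGaussianProcess G P)
    (hGmean : ∀ t, ∫ ω, G t ω ∂P = 0)
    (hGvar : ∀ t : ℝ≥0, variance (G t) P = 2 * (t : ℝ) ^ (2 * β / α))
    -- `Λ ≥ 0` is independent of `G`, with law the fundamental solution at time `1`
    (hΛ₀ : ∀ᵐ ω ∂P, 0 ≤ Λ ω)
    (hΛ : HasLaw Λ (STFD.fundamentalSolution (α / 2) β (-(α / 2)) 1) P)
    (hind : IndepFun Λ (fun ω t => G t ω) P) :
    -- existence and uniqueness of the fundamental solution of the symmetric equation
    STFD.IsFundamentalSolution α β 0 (STFD.fundamentalSolution α β 0) ∧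
    (∀ K, STFD.IsFundamentalSolution α β 0 K → K = STFD.fundamentalSolution α β 0) ∧
    -- uniqueness of the one that governs `Λ`
    (∀ K, STFD.IsFundamentalSolution (α / 2) β (-(α / 2)) K →
      K = STFD.fundamentalSolution (α / 2) β (-(α / 2))) ∧
    -- the one-time law of `X` is the fundamental solution
    (∀ t, HasLaw (STFD.scaleMixtureProcess Λ G t) (STFD.fundamentalSolution α β 0 t) P) ∧
    -- which has, at positive times, the Gaussian mixture density, vanishing at infinity
    (∀ t, 0 < t →
      STFD.fundamentalSolution α β 0 t = volume.withDensity (fun x : ℝ =>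
        ∫⁻ ξ, ENNReal.ofReal (STFD.gaussKernel x ξ)
          ∂(STFD.fundamentalSolution (α / 2) β (-(α / 2)) t)) ∧
      Tendsto (fun x : ℝ => ∫⁻ ξ, ENNReal.ofReal (STFD.gaussKernel x ξ)
          ∂(STFD.fundamentalSolution (α / 2) β (-(α / 2)) t)) (cocompact ℝ) (𝓝 0)) ∧
    -- the finite-dimensional laws are variance mixtures of Gaussian laws
    (∀ (n : ℕ) (t : Fin n → ℝ≥0) (B : Set (EuclideanSpace ℝ (Fin n))), MeasurableSet B →
      P.map (STFD.timeVector (STFD.scaleMixtureProcess Λ G) t) B =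
        ∫⁻ l, multivariateGaussian 0 (l • STFD.covMatrix G P t) B
          ∂(STFD.fundamentalSolution (α / 2) β (-(α / 2)) 1)) ∧
    -- with the mixture density when the covariance matrix is invertible
    (∀ (n : ℕ) (t : Fin n → ℝ≥0), (STFD.covMatrix G P t).det ≠ 0 →
      P.map (STFD.timeVector (STFD.scaleMixtureProcess Λ G) t) =
        volume.withDensity (fun x : EuclideanSpace ℝ (Fin n) =>
          ∫⁻ l, ENNReal.ofReal (STFD.gaussVectorDensity (STFD.covMatrix G P t) l x)
            ∂(STFD.fundamentalSolution (α / 2) β (-(α / 2)) 1))) ∧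
    -- and `X` is H-SSSI with `H = β/α` as soon as `G` is
    (STFD.IsHSSSI (β / α) G P → STFD.IsHSSSI (β / α) (STFD.scaleMixtureProcess Λ G) P) := by
  have ha₀ : 0 < α / 2 := by positivity
  have ha₁ : α / 2 ≤ 1 := by linarith
  have hb : 0 < 2 * β / α := by positivity
  have hba : β / (α / 2) = 2 * β / α := by field_simp
  have hΛm : AEMeasurable Λ P := hΛ.aemeasurable
  set F := STFD.fundamentalSolution (α / 2) β (-(α / 2)) with hFdef
  have hmap : P.map Λ = F 1 := hΛ.map_eq
  have hprob : IsProbabilityMeasure (F 1) := hmap ▸ Measure.isProbabilityMeasure_map hΛm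
  -- Being the law of Λ, `F 1` has mass one, so F is not the default zero family.
  have hF : STFD.IsFundamentalSolution (α / 2) β (-(α / 2)) F :=
    STFD.isFundamentalSolution_of_ne_zero (t := 1) (IsProbabilityMeasure.ne_zero _)
  have hsymb := STFD.rieszFellerSymbol_neg_re_nonpos ha₀ ha₁
  have hρ : ∀ᵐ l ∂(F 1), 0 ≤ l := by
    rwa [← hmap, ae_map_iff hΛm measurableSet_Ici]
  have hres : ∀ s : ℝ, 0 < s → ∀ x : ℝ, 0 ≤ x → (s ^ β + x ^ (α / 2)) *
      ∫ t in Ioi (0 : ℝ), Real.exp (-(s * t)) * mgf id (F 1) (-(x * t ^ (2 * β / α)))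
        = s ^ (β - 1) := fun s hs x hx => by
    rw [← hba]
    exact hF.resolvent_mgf ha₀ ha₁ rfl hρ hs hx
  -- At λ = 0 the mixture component is a Dirac mass, so the density formulas require that Λ has no
  -- atom there.
  have hρ0 : F 1 {0} = 0 := STFD.measure_singleton_zero_of_resolvent hρ ha₀ hb fun x hx => by
    simpa only [Real.one_rpow] using hres 1 one_pos x hx
  have hρpos : ∀ᵐ l ∂(F 1), 0 < l := by
    filter_upwards [hρ, measure_eq_zero_iff_ae_notMem.1 hρ0] with l h1 h2
    exact lt_of_le_of_ne h1 (Ne.symm h2)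
  have hGm : ∀ t, AEMeasurable (G t) P := hG.aemeasurable
  have hGlaw : ∀ t : ℝ≥0, P.map (G t) = gaussianReal 0 (2 * (t : ℝ) ^ (2 * β / α)).toNNReal :=
    fun t => by rw [(hG.hasGaussianLaw_eval t).map_eq_gaussianReal, hGmean, hGvar]
  have hindt : ∀ t, IndepFun Λ (G t) P := fun t =>
    hind.comp measurable_id (measurable_pi_apply t)
  have hXm : ∀ t, AEMeasurable (STFD.scaleMixtureProcess Λ G t) P := fun t =>
    hΛm.sqrt.mul (hGm t)
  have hK : STFD.IsFundamentalSolution α β 0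
      (fun t => P.map (STFD.scaleMixtureProcess Λ G t)) := by
    refine STFD.isFundamentalSolution_of_charFun_eq_mgf hα₀ hβ₀ hρ hres
      (fun t => inferInstance) fun t κ => ?_
    have h := STFD.charFun_map_sqrt_mul hΛm hΛ₀ (hGm t) (hindt t)
      (v := (t : ℝ) ^ (2 * β / α)) (by positivity) (hGlaw t) κ
    rw [hmap] at h
    exact h
  have hsymb0 : ∀ κ, (STFD.rieszFellerSymbol α 0 κ).re ≤ 0 := fun κ => by
    rw [STFD.rieszFellerSymbol_symm, Complex.neg_re, Complex.ofReal_re, neg_nonpos]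
    positivity
  have hK0 := STFD.isFundamentalSolution_fundamentalSolution ⟨_, hK⟩
  have hKeq : ∀ t, P.map (STFD.scaleMixtureProcess Λ G t) = STFD.fundamentalSolution α β 0 t :=
    fun t => congrFun (hK.unique hsymb0 hK0) t
  have hvec : ∀ (n : ℕ) (t : Fin n → ℝ≥0), STFD.timeVector (STFD.scaleMixtureProcess Λ G) t
      = fun ω => Real.sqrt (Λ ω) • STFD.timeVector G t ω := fun n t => rfl
  have hvm : ∀ (n : ℕ) (t : Fin n → ℝ≥0), AEMeasurable (STFD.timeVector G t) P := fun n t =>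
    (STFD.hasGaussianLaw_timeVector hG t).aemeasurable
  have hvind : ∀ (n : ℕ) (t : Fin n → ℝ≥0), IndepFun Λ (STFD.timeVector G t) P := fun n t =>
    hind.comp (ψ := fun g : ℝ≥0 → ℝ => (WithLp.toLp 2 fun i => g (t i) : EuclideanSpace ℝ (Fin n)))
      measurable_id (by fun_prop)
  refine ⟨hK0, fun K h => h.unique hsymb0 hK0, fun K h => h.unique hsymb hF,
    fun t => ⟨hXm t, hKeq t⟩, fun t ht => ⟨?_, ?_⟩, fun n t B hB => ?_, fun n t hdet => ?_,
    fun h => h.sqrt_mul_of_indepFun hΛm hind⟩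
  -- The variance factor t^(2β/α) is absorbed into the mixing law, which by self-similarity becomes
  -- the extremal solution at time t.
  · have h := STFD.map_sqrt_mul_eq_withDensity hΛm (by rwa [hmap]) (hGm t) (hindt t)
      (v := (t : ℝ) ^ (2 * β / α)) (Real.rpow_pos_of_pos (by exact_mod_cast ht) _) (hGlaw t)
    rw [hmap, ← hba, ← hF.eq_map ha₀ hsymb ht] at h
    rw [← hKeq t]
    exact h
  · have := hF.finite t
    exact STFD.tendsto_lintegral_gaussKernel _
  · rw [hvec, STFD.map_sqrt_smul_apply hΛm (hvm n t) (hvind n t) hB, hmap,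
      STFD.map_timeVector_eq_multivariateGaussian hG hGmean]
    refine lintegral_congr_ae ?_
    filter_upwards [hρ] with l hl
    rw [STFD.map_smul_multivariateGaussian (STFD.posSemidef_covMatrix hG t) hl]
  · have hS := STFD.posSemidef_covMatrix hG t
    rw [hvec, STFD.map_sqrt_smul_eq_withDensity (m := volume) hΛm (hvm n t) (hvind n t)
      (f := fun l x => ENNReal.ofReal (STFD.gaussVectorDensity (STFD.covMatrix G P t) l x))
      (STFD.measurable_gaussVectorDensity _).ennreal_ofReal ?_, hmap]
    rw [hmap, STFD.map_timeVector_eq_multivariateGaussian hG hGmean]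
    filter_upwards [hρpos] with l hl
    rw [STFD.map_smul_multivariateGaussian hS hl.le, ← STFD.gaussVectorDensity_smul _ hl]
    refine STFD.multivariateGaussian_eq_withDensity (hS.smul hl.le) ?_
    rw [Matrix.det_smul]
    exact mul_ne_zero (pow_ne_zero _ hl.ne') hdet
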